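/- Let $\zeta$ be the Riemann zeta function, $\zeta^{(k)}$ its $k$th derivative, and for $n\in\mathbb{Z}$, $t\in\mathbb{R}$ put $$e_n(t)=\left(\frac{\frac12-it}{\frac12+it}\right)^n .$$ Let $\sigma_0>1/2$ be real. Then for every $t\in\mathbb{R}$ the following holds, where each series over $n\ge 1$ converges as the limit of its partial sums. (i) If $\sigma_0<1$, then $$\zeta(\sigma_0+it)=\zeta\left(\sigma_0+\tfrac12\right)-\frac{1}{\sigma_0-\frac12}+\frac{1}{\sigma_0-1+it}+\sum_{n\ge1}\ell_n(\sigma_0)\,e_n(t),$$ where, for every integer $n\ge1$, $$\ell_n(\sigma_0)=(-1)^n\sum_{k=1}^n\binom{n-1}{k-1}\left(\frac{1}{k!}\zeta^{(k)}\left(\sigma_0+\tfrac12\right)-\frac{(-1)^k}{\left(\sigma_0-\frac12\right)^{k+1}}\right).$$ (ii) If $\sigma_0>1$, then $$\zeta(\sigma_0+it)=\zeta\left(\sigma_0+\tfrac12\right)+\sum_{n\ge1}\ell_n(\sigma_0)\,e_n(t),$$ where, for every integer $n\ge1$, $$\ell_n(\sigma_0)=(-1)^n\sum_{k=1}^n\binom{n-1}{k-1}\frac{1}{k!}\zeta^{(k)}\left(\sigma_0+\tfrac12\right).$$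 -/

import Mathlib

/-- The function `e_n(t) = ((1/2 - it) / (1/2 + it)) ^ n` of the real variable `t`, for `n ∈ ℤ`. -/
noncomputable def fourierE (n : ℤ) (t : ℝ) : ℂ :=
  ((1 / 2 - Complex.I * (t : ℂ)) / (1 / 2 + Complex.I * (t : ℂ))) ^ n

/-- The coefficient `ℓ_n(σ₀)`, `n ≥ 1`, in the range `1/2 < σ₀ < 1`. The derivative of order `k` of
the zeta function is the complex one, taken at the point `σ₀ + 1/2`. -/
noncomputable def ellStrip (σ₀ : ℝ) (n : ℕ) : ℂ :=
  (-1) ^ n * ∑ k ∈ Finset.Icc 1 n, ((n - 1).choose (k - 1) : ℂ) *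
    (1 / (k.factorial : ℂ) * iteratedDeriv k riemannZeta ((σ₀ : ℂ) + 1 / 2)
      - (-1) ^ k / ((σ₀ : ℂ) - 1 / 2) ^ (k + 1))

/-- The coefficient `ℓ_n(σ₀)`, `n ≥ 1`, in the range `σ₀ > 1`. -/
noncomputable def ellRight (σ₀ : ℝ) (n : ℕ) : ℂ :=
  (-1) ^ n * ∑ k ∈ Finset.Icc 1 n, ((n - 1).choose (k - 1) : ℂ) *
    (1 / (k.factorial : ℂ) * iteratedDeriv k riemannZeta ((σ₀ : ℂ) + 1 / 2))

/-- The coefficient `ℓ_n(σ₀)`, `n ≥ 1`, for `σ₀ > 1/2`, `σ₀ ≠ 1`. -/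
noncomputable def ell (σ₀ : ℝ) (n : ℕ) : ℂ :=
  if σ₀ < 1 then ellStrip σ₀ n else ellRight σ₀ n

/-- The series `∑_{n ≥ 1} a n` converges to `S`, as the limit of its partial sums
(the convergence need not be absolute). -/
def SeriesFromOneConvergesTo (a : ℕ → ℂ) (S : ℂ) : Prop :=
  Filter.Tendsto (fun N : ℕ => ∑ n ∈ Finset.Icc 1 N, a n) Filter.atTop (nhds S)

/-!
With `s = 1 / 2 + i t` and `w = (1 - s) / s` one has `e_n(t) = w ^ n` and `s = (1 + w)⁻¹`, so both
expansions are statements about the Taylor series at `0` of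
`F w = Φ (σ₀ - 1 / 2 + (1 + w)⁻¹)` at a point of the unit circle other than `-1`. Here `Φ` is the
zeta function if `σ₀ > 1`, and the zeta function with its pole removed (`riemannZeta₀`) if
`σ₀ < 1`. The unit disc corresponds to the half plane to the right of `re = σ₀`, so `F` is
holomorphic around every point of the closed disc except `-1`.

* The Taylor coefficients of `F` are computed from the higher derivatives of a function of
  `(1 + w)⁻¹`, which involve Lah numbers (`iteratedDeriv_comp_const_add_inv`).
* Near `w = -1` one has `‖F w‖ ≤ C ‖1 + w‖ ^ (-1 / 2)`. This is the bound
  `‖riemannZeta₀ s‖ ≤ C ‖s‖ ^ (1 / 2)` on `σ₀ ≤ re s`, `σ₀ > 1 / 2`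
  (`exists_norm_riemannZeta₀_le`). It follows by comparing `(n + 1) ^ (-s)` with the integral of
  `x ^ (-s)` over `[n + 1, n + 2]`, and interpolating between two bounds for the difference.
  For `σ₀ > 1` the pole adds a bounded term.
* A Taylor series converges at a boundary point `w₀` where `F` is holomorphic as soon as the
  singularity at `-1` is integrable (`tendsto_sum_taylor_of_norm_eq_one`). Writing
  `F w = F w₀ + (w - w₀) * G w`, the partial sums at `w₀` telescope to `F w₀` up to the error
  `w₀ ^ (N + 1) * g_N`, where `g_N` is the `N`-th Taylor coefficient of `G`. The function `G` has
  the same growth at `-1`, so `g_N` is a Fourier coefficient of the integrable boundary function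
  of `G`, and tends to `0` by the Riemann-Lebesgue lemma.
-/

open Complex Filter Topology Set

/-! ### Growth of the zeta function to the right of the critical line -/

lemma norm_cpow_sub_cpow_le_two_mul {s : ℂ} (hs : 0 < s.re) {m x : ℝ} (hm : 0 < m) (hx : m ≤ x) :
    ‖(m : ℂ) ^ (-s) - (x : ℂ) ^ (-s)‖ ≤ 2 * m ^ (-s.re) := by
  refine (norm_sub_le _ _).trans ?_
  rw [norm_cpow_eq_rpow_re_of_pos hm, norm_cpow_eq_rpow_re_of_pos (hm.trans_le hx), neg_re]
  have := Real.rpow_le_rpow_of_nonpos hm hx (neg_nonpos.mpr hs.le)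
  linarith

lemma norm_cpow_sub_cpow_le_norm_mul {s : ℂ} (hs : 0 < s.re) {m x : ℝ} (hm : 0 < m) (hx : m ≤ x)
    (hx' : x ≤ m + 1) :
    ‖(m : ℂ) ^ (-s) - (x : ℂ) ^ (-s)‖ ≤ ‖s‖ * m ^ (-s.re - 1) := by
  have hs0 : -s ≠ 0 := neg_ne_zero.mpr fun h => by simp [h] at hs
  have key := norm_image_sub_le_of_norm_deriv_le_segment' (f := fun y : ℝ => (y : ℂ) ^ (-s))
    (f' := fun y : ℝ => -s * (y : ℂ) ^ (-s - 1)) (a := m) (b := x) (C := ‖s‖ * m ^ (-s.re - 1))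
    (fun y hy => (hasDerivAt_ofReal_cpow_const (hm.trans_le hy.1).ne' hs0).hasDerivWithinAt)
    (fun y hy => by
      rw [norm_mul, norm_neg, norm_cpow_eq_rpow_re_of_pos (hm.trans_le hy.1)]
      simp only [sub_re, neg_re, one_re]
      gcongr ?_ * ?_
      exact Real.rpow_le_rpow_of_nonpos hm hy.1 (by linarith)) x ⟨hx, le_rfl⟩
  rw [norm_sub_rev]
  refine key.trans (mul_le_of_le_one_right (by positivity) (by linarith))

/-- Interpolation between the trivial bound and the mean value bound: the former decays too slowly
in `m`, the latter grows too fast in `s`. -/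
lemma norm_cpow_sub_cpow_le {s : ℂ} (hs : 0 < s.re) {a : ℝ} (ha0 : 0 ≤ a) (ha1 : a ≤ 1) {m x : ℝ}
    (hm : 0 < m) (hx : m ≤ x) (hx' : x ≤ m + 1) :
    ‖(m : ℂ) ^ (-s) - (x : ℂ) ^ (-s)‖ ≤ 2 * ‖s‖ ^ a * m ^ (-(s.re + a)) := by
  set D := ‖(m : ℂ) ^ (-s) - (x : ℂ) ^ (-s)‖
  have h1 := norm_cpow_sub_cpow_le_two_mul hs hm hx
  have h2 := norm_cpow_sub_cpow_le_norm_mul hs hm hx hx'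
  have hD : 0 ≤ D := norm_nonneg _
  calc D = D ^ (1 - a) * D ^ a := by
        rw [← Real.rpow_add_of_nonneg hD (by linarith) ha0]; simp
    _ ≤ (2 * m ^ (-s.re)) ^ (1 - a) * (‖s‖ * m ^ (-s.re - 1)) ^ a := by
        gcongr
    _ = 2 ^ (1 - a) * ‖s‖ ^ a * m ^ (-(s.re + a)) := by
        rw [Real.mul_rpow (by norm_num) (by positivity), Real.mul_rpow (by positivity)
          (by positivity), ← Real.rpow_mul hm.le, ← Real.rpow_mul hm.le]
        have : m ^ (-(s.re + a)) = m ^ (-s.re * (1 - a)) * m ^ ((-s.re - 1) * a) := by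
          rw [← Real.rpow_add hm]; congr 1; ring
        rw [this]; ring
    _ ≤ 2 * ‖s‖ ^ a * m ^ (-(s.re + a)) := by
        gcongr
        calc (2 : ℝ) ^ (1 - a) ≤ 2 ^ (1 : ℝ) :=
              Real.rpow_le_rpow_of_exponent_le (by norm_num) (by linarith)
          _ = 2 := Real.rpow_one 2

/-- With `m = n + 1`, the quantity `(s - 1) * ∫ x in m..m + 1, (m ^ (-s) - x ^ (-s))`, written in
the closed form that makes sense at `s = 1` as well. The terms sum to `(s - 1) * riemannZeta₀ s`. -/
noncomputable def zetaTerm (n : ℕ) (s : ℂ) : ℂ :=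
  (s - 1) * ((n + 1 : ℝ) : ℂ) ^ (-s) + ((n + 2 : ℝ) : ℂ) ^ (1 - s) - ((n + 1 : ℝ) : ℂ) ^ (1 - s)

lemma norm_zetaTerm_le {s : ℂ} (hs : 0 < s.re) {a : ℝ} (ha0 : 0 ≤ a) (ha1 : a ≤ 1) (n : ℕ) :
    ‖zetaTerm n s‖ ≤ 2 * ‖s - 1‖ * ‖s‖ ^ a * (n + 1 : ℝ) ^ (-(s.re + a)) := by
  rcases eq_or_ne s 1 with rfl | hs1
  · simp [zetaTerm]
  have hs1' : 1 - s ≠ 0 := sub_ne_zero.mpr hs1.symm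
  have hm : (0 : ℝ) < n + 1 := by positivity
  have key := norm_image_sub_le_of_norm_deriv_le_segment'
    (f := fun y : ℝ => (s - 1) * ((n + 1 : ℝ) : ℂ) ^ (-s) * (y - (n + 1 : ℝ)) + (y : ℂ) ^ (1 - s))
    (f' := fun y : ℝ => (s - 1) * (((n + 1 : ℝ) : ℂ) ^ (-s) - (y : ℂ) ^ (-s)))
    (a := (n + 1 : ℝ)) (b := (n + 2 : ℝ))
    (C := ‖s - 1‖ * (2 * ‖s‖ ^ a * (n + 1 : ℝ) ^ (-(s.re + a))))
    (fun y hy => by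
      refine HasDerivAt.hasDerivWithinAt ?_
      have h1 := hasDerivAt_ofReal_cpow_const (hm.trans_le hy.1).ne' hs1'
      have h2 := (((hasDerivAt_id y).ofReal_comp).sub_const (((n + 1 : ℝ) : ℂ))).const_mul
        ((s - 1) * ((n + 1 : ℝ) : ℂ) ^ (-s))
      convert! h2.add h1 using 1
      rw [show 1 - s - 1 = -s by ring]
      push_cast; ring)
    (fun y hy => by
      rw [norm_mul]
      gcongr
      exact norm_cpow_sub_cpow_le hs ha0 ha1 hm hy.1 (by linarith [hy.2]))
    (n + 2 : ℝ) ⟨by linarith, le_rfl⟩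
  convert key using 1
  · congr 1
    simp only [zetaTerm]; push_cast; ring
  · ring

lemma summable_add_one_rpow {b : ℝ} (hb : 1 < b) :
    Summable fun n : ℕ => (n + 1 : ℝ) ^ (-b) := by
  have := (Real.summable_one_div_nat_add_rpow 1 b).mpr hb
  refine this.congr fun n => ?_
  rw [abs_of_pos (by positivity), Real.rpow_neg (by positivity), one_div]

lemma summable_zetaTerm {s : ℂ} (hs : 0 < s.re) : Summable fun n => zetaTerm n s :=
  .of_norm_bounded ((summable_add_one_rpow (b := s.re + 1) (by linarith)).mul_left _)
    (norm_zetaTerm_le hs zero_le_one le_rfl)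

lemma tsum_zetaTerm_of_one_lt_re {s : ℂ} (hs : 1 < s.re) :
    ∑' n, zetaTerm n s = (s - 1) * riemannZeta s - 1 := by
  have hs1 : s.re ≠ 0 := by linarith
  have hZ : HasSum (fun n : ℕ => (s - 1) * ((n + 1 : ℝ) : ℂ) ^ (-s)) ((s - 1) * riemannZeta s) := by
    refine HasSum.mul_left _ ?_
    have h := (Complex.summable_one_div_nat_cpow.mpr hs)
    rw [← summable_nat_add_iff 1] at h
    rw [zeta_eq_tsum_one_div_nat_add_one_cpow hs]
    convert! h.hasSum using 1
    · ext n; simp [cpow_neg]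
    · simp
  -- the remaining differences telescope, and `(N + 1) ^ (1 - s)` tends to `0`
  have hT : Tendsto (fun N : ℕ => ∑ n ∈ Finset.range N, zetaTerm n s) atTop
      (𝓝 ((s - 1) * riemannZeta s - 1)) := by
    have h0 : Tendsto (fun N : ℕ => ((N + 1 : ℝ) : ℂ) ^ (1 - s)) atTop (𝓝 0) := by
      rw [tendsto_zero_iff_norm_tendsto_zero]
      have : Tendsto (fun N : ℕ => ((N : ℝ) + 1) ^ (-(s.re - 1))) atTop (𝓝 0) :=
        (tendsto_rpow_neg_atTop (by linarith)).comp
          (tendsto_atTop_add_const_right _ _ tendsto_natCast_atTop_atTop)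
      refine this.congr fun N => ?_
      rw [norm_cpow_eq_rpow_re_of_pos (by positivity)]
      simp
    have h1 := hZ.tendsto_sum_nat.add (h0.sub_const 1)
    rw [zero_sub, ← sub_eq_add_neg] at h1
    refine h1.congr fun N => ?_
    have h2 := Finset.sum_range_sub (fun n : ℕ => ((n + 1 : ℝ) : ℂ) ^ (1 - s)) N
    simp only [zetaTerm, add_sub_assoc, Finset.sum_add_distrib]
    congr 1
    convert! h2.symm using 1
    · simp
    · refine Finset.sum_congr rfl fun n _ => ?_
      push_cast; ring_nf
  exact tendsto_nhds_unique ((summable_zetaTerm (by linarith)).hasSum.tendsto_sum_nat) hT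

lemma differentiable_zetaTerm (n : ℕ) : Differentiable ℂ (zetaTerm n) := by
  have h1 : ((n + 1 : ℝ) : ℂ) ≠ 0 := by exact_mod_cast (by positivity : (n + 1 : ℝ) ≠ 0)
  have h2 : ((n + 2 : ℝ) : ℂ) ≠ 0 := by exact_mod_cast (by positivity : (n + 2 : ℝ) ≠ 0)
  intro s
  unfold zetaTerm
  refine ((DifferentiableAt.mul (by fun_prop) (.const_cpow (by fun_prop) (.inl h1))).add
    (.const_cpow (by fun_prop) (.inl h2))).sub (.const_cpow (by fun_prop) (.inl h1))

/-- Both sides are holomorphic for `0 < s.re` and agree for `1 < s.re`. -/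
lemma tsum_zetaTerm {s : ℂ} (hs : 0 < s.re) :
    ∑' n, zetaTerm n s = (s - 1) * riemannZeta₀ s := by
  set ε := min (s.re / 2) 1
  have hε0 : 0 < ε := lt_min (by linarith) one_pos
  set R := ‖s‖ + 3 with hR
  have hR0 : 3 ≤ R := by rw [hR]; linarith [norm_nonneg s]
  set V : Set ℂ := {z | ε < z.re} ∩ Metric.ball 0 R
  have hVo : IsOpen V := (isOpen_lt continuous_const continuous_re).inter Metric.isOpen_ball
  have hVc : IsPreconnected V :=
    ((convex_halfSpace_re_gt ε).inter (convex_ball 0 R)).isPreconnected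
  have hsV : s ∈ V := ⟨(min_le_left _ _).trans_lt (half_lt_self hs), by simp [hR]⟩
  have h2V : (2 : ℂ) ∈ V := ⟨(min_le_right _ _).trans_lt (by simp : (1 : ℝ) < (2 : ℂ).re), by
    simp only [Metric.mem_ball, dist_zero_right, Complex.norm_ofNat]; linarith⟩
  have hd : DifferentiableOn ℂ (fun z => ∑' n, zetaTerm n z) V := by
    refine differentiableOn_tsum_of_summable_norm
      (u := fun n : ℕ => 2 * (R + 1) * R * (n + 1 : ℝ) ^ (-(ε + 1)))
      ((summable_add_one_rpow (by linarith)).mul_left _)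
      (fun n => (differentiable_zetaTerm n).differentiableOn) hVo fun n z hz => ?_
    have hz1 : ε < z.re := hz.1
    have hz2 : ‖z‖ < R := by simpa using hz.2
    refine (norm_zetaTerm_le (hε0.trans hz1) zero_le_one le_rfl n).trans ?_
    rw [Real.rpow_one]
    gcongr
    · exact (norm_sub_le _ _).trans (by simpa using hz2.le)
    · linarith
  have hd' : DifferentiableOn ℂ (fun z => (z - 1) * riemannZeta₀ z) V := by fun_prop
  refine (hd.analyticOnNhd hVo).eqOn_of_preconnected_of_eventuallyEq (hd'.analyticOnNhd hVo) hVc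
    h2V ?_ hsV
  filter_upwards [(isOpen_lt continuous_const continuous_re).mem_nhds
    (show (1 : ℝ) < (2 : ℂ).re by norm_num)] with z hz
  have hz1 : z ≠ 1 := by rintro rfl; simp at hz
  rw [tsum_zetaTerm_of_one_lt_re hz, riemannZeta_eq_inv_sub_add hz1]
  field_simp [sub_ne_zero.mpr hz1]
  ring

/-- The bound is useful for `a < 1`; the condition `1 < σ + a` makes the comparison series converge
uniformly in `σ ≤ s.re`. -/
lemma exists_norm_riemannZeta₀_le {σ a : ℝ} (hσ : 0 < σ) (ha0 : 0 ≤ a) (ha1 : a ≤ 1)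
    (hσa : 1 < σ + a) :
    ∃ C, 0 ≤ C ∧ ∀ s : ℂ, σ ≤ s.re → ‖riemannZeta₀ s‖ ≤ C * ‖s‖ ^ a := by
  have hsum := (summable_add_one_rpow hσa).mul_left 2
  -- the series only determines `(s - 1) * riemannZeta₀ s`, so `s = 1` is put into the constant
  refine ⟨max (∑' n : ℕ, 2 * (n + 1 : ℝ) ^ (-(σ + a))) ‖riemannZeta₀ 1‖,
    le_max_of_le_right (norm_nonneg _), fun s hs => ?_⟩
  rcases eq_or_ne s 1 with rfl | hs1
  · simp
  have hs0 : 0 < s.re := hσ.trans_le hs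
  have hpos : 0 < ‖s - 1‖ := norm_pos_iff.mpr (sub_ne_zero.mpr hs1)
  have h : ‖∑' n, zetaTerm n s‖ ≤
      ‖s - 1‖ * ‖s‖ ^ a * ∑' n : ℕ, 2 * (n + 1 : ℝ) ^ (-(σ + a)) := by
    refine tsum_of_norm_bounded (hsum.hasSum.mul_left _) fun n => ?_
    refine (norm_zetaTerm_le hs0 ha0 ha1 n).trans ?_
    have : (n + 1 : ℝ) ^ (-(s.re + a)) ≤ (n + 1 : ℝ) ^ (-(σ + a)) :=
      Real.rpow_le_rpow_of_exponent_le (by linarith [n.cast_nonneg (α := ℝ)]) (by linarith)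
    calc _ = ‖s - 1‖ * ‖s‖ ^ a * (2 * (n + 1 : ℝ) ^ (-(s.re + a))) := by ring
      _ ≤ _ := by gcongr
  rw [tsum_zetaTerm hs0, norm_mul, mul_assoc] at h
  refine (le_of_mul_le_mul_left h hpos).trans ?_
  rw [mul_comm]
  gcongr
  exact le_max_left _ _

/-! ### Taylor series on the boundary circle -/

/-- A lower bound for the distance to `-1`, uniform in the radius `r`: the square of the left-hand
side is at most `sin ((θ - π) / 2) ^ 2 = (1 + cos θ) / 2`. -/
lemma abs_sub_pi_div_pi_le_norm_one_add_circleMap {r θ : ℝ} (hr : 0 ≤ r)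
    (hθ : |θ - Real.pi| ≤ Real.pi) :
    |θ - Real.pi| / Real.pi ≤ ‖1 + circleMap 0 r θ‖ := by
  have hpi := Real.pi_pos
  have h1 : |θ - Real.pi| / Real.pi ≤ |Real.sin ((θ - Real.pi) / 2)| := by
    have h := Real.mul_abs_le_abs_sin (x := (θ - Real.pi) / 2)
      (by rw [abs_div, abs_two]; linarith)
    rw [abs_div, abs_two] at h
    convert h using 1
    ring
  refine h1.trans (abs_le_of_sq_le_sq ?_ (norm_nonneg _))
  have h2 : Real.sin ((θ - Real.pi) / 2) ^ 2 = (1 + Real.cos θ) / 2 := by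
    rw [Real.sin_sq_eq_half_sub, mul_div_cancel₀ _ two_ne_zero, Real.cos_sub_pi]; ring
  have h3 : ‖1 + circleMap 0 r θ‖ ^ 2 = 1 + 2 * r * Real.cos θ + r ^ 2 := by
    rw [Complex.sq_norm, normSq_apply, circleMap_zero, exp_mul_I]
    simp only [add_re, add_im, one_re, one_im, mul_re, mul_im, ofReal_re, ofReal_im, I_re, I_im,
      cos_ofReal_re, cos_ofReal_im, sin_ofReal_re, sin_ofReal_im]
    linear_combination r ^ 2 * Real.sin_sq_add_cos_sq θ
  rw [h2, h3]
  have hc := Real.cos_le_one θ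
  have hc' := Real.neg_one_le_cos θ
  rcases le_total (Real.cos θ) 0 with h | h
  · nlinarith [sq_nonneg (r + Real.cos θ)]
  · nlinarith [mul_nonneg hr h, sq_nonneg r]

lemma intervalIntegrable_abs_sub_pi_rpow {b : ℝ} (hb : -1 < b) :
    IntervalIntegrable (fun θ : ℝ => |θ - Real.pi| ^ b) MeasureTheory.volume 0 (2 * Real.pi) := by
  have hpi := Real.pi_pos
  have h0 : IntervalIntegrable (fun θ : ℝ => |θ| ^ b) MeasureTheory.volume 0 Real.pi := by
    refine (intervalIntegral.intervalIntegrable_rpow' hb).congr fun x hx => ?_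
    rw [uIoc_of_le hpi.le] at hx
    simp [abs_of_pos hx.1]
  have h1 : IntervalIntegrable (fun θ : ℝ => |θ| ^ b) MeasureTheory.volume (-Real.pi) 0 := by
    have := h0.comp_sub_left 0
    simp only [zero_sub, abs_neg, sub_zero] at this
    simpa using this.symm
  have := (h1.trans h0).comp_sub_right Real.pi
  simpa [two_mul] using this

/-- Cauchy's formula for the Taylor coefficients, over a circle of radius `r < 1`. -/
lemma iteratedDeriv_div_factorial_mul_pow_eq {G : ℂ → ℂ}
    (hG : DifferentiableOn ℂ G (Metric.ball 0 1)) (n : ℕ) {r : ℝ} (hr0 : 0 < r) (hr1 : r < 1) :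
    iteratedDeriv n G 0 / n.factorial * (r : ℂ) ^ n = (2 * Real.pi : ℂ)⁻¹ *
      ∫ θ in (0 : ℝ)..2 * Real.pi, exp (-(n * θ * I)) * G (circleMap 0 r θ) := by
  have h := (hG.mono (Metric.closedBall_subset_ball hr1)).circleIntegral_one_div_sub_center_pow_smul
    hr0 n
  have hrc : (r : ℂ) ≠ 0 := by exact_mod_cast hr0.ne'
  have hpi : (Real.pi : ℂ) ≠ 0 := by exact_mod_cast Real.pi_ne_zero
  have e : ∀ θ : ℝ, deriv (circleMap 0 r) θ •
      ((1 / (circleMap 0 r θ - 0) ^ (n + 1)) • G (circleMap 0 r θ)) =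
      (I / (r : ℂ) ^ n) * (exp (-(n * θ * I)) * G (circleMap 0 r θ)) := by
    intro θ
    have hc : circleMap 0 r θ ≠ 0 := circleMap_ne_center hr0.ne'
    have he : exp (-(n * θ * I)) = (exp (θ * I) ^ n)⁻¹ := by
      rw [← exp_nat_mul, ← exp_neg]; congr 1; ring
    rw [deriv_circleMap, he, sub_zero, smul_eq_mul, smul_eq_mul, pow_succ]
    have hc' : circleMap 0 r θ ^ n = (r : ℂ) ^ n * exp (θ * I) ^ n := by
      rw [circleMap_zero, mul_pow]
    rw [show exp (θ * I) ^ n = circleMap 0 r θ ^ n / (r : ℂ) ^ n by rw [hc']; field_simp]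
    field_simp
  rw [circleIntegral, intervalIntegral.integral_congr fun θ _ => e θ,
    intervalIntegral.integral_const_mul, smul_eq_mul] at h
  have hf : (n.factorial : ℂ) ≠ 0 := by exact_mod_cast n.factorial_ne_zero
  have hI := I_ne_zero
  field_simp at h ⊢
  linear_combination -h

/-- Letting the radius tend to `1` in Cauchy's formula: the exponent `a < 1` makes the singularity
at `-1` integrable, which gives the dominating function. -/
lemma iteratedDeriv_div_factorial_eq_integral {G : ℂ → ℂ} {C a : ℝ}
    (hG : DifferentiableOn ℂ G (Metric.ball 0 1))
    (hGc : ContinuousOn G (Metric.closedBall 0 1 \ {-1})) (hC : 0 ≤ C) (ha0 : 0 ≤ a) (ha1 : a < 1)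
    (hbound : ∀ w ∈ Metric.ball (0 : ℂ) 1, ‖G w‖ ≤ C * ‖1 + w‖ ^ (-a)) (n : ℕ) :
    iteratedDeriv n G 0 / n.factorial = (2 * Real.pi : ℂ)⁻¹ *
      ∫ θ in (0 : ℝ)..2 * Real.pi, exp (-(n * θ * I)) * G (circleMap 0 1 θ) := by
  have hpi := Real.pi_pos
  have hI1 : ∀ᶠ r : ℝ in 𝓝[<] 1, 0 < r ∧ r < 1 :=
    Ioo_mem_nhdsLT (zero_lt_one (α := ℝ))
  have hL : Tendsto (fun r : ℝ => iteratedDeriv n G 0 / n.factorial * (r : ℂ) ^ n) (𝓝[<] 1)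
      (𝓝 (iteratedDeriv n G 0 / n.factorial)) := by
    have : Continuous fun r : ℝ => iteratedDeriv n G 0 / n.factorial * (r : ℂ) ^ n := by fun_prop
    simpa using (this.tendsto 1).mono_left nhdsWithin_le_nhds
  refine tendsto_nhds_unique (hL.congr' (hI1.mono fun r hr =>
    iteratedDeriv_div_factorial_mul_pow_eq hG n hr.1 hr.2)) (Tendsto.const_mul _ ?_)
  have hmem : ∀ θ : ℝ, θ ∈ uIoc 0 (2 * Real.pi) → |θ - Real.pi| ≤ Real.pi := fun θ hθ => by
    rw [uIoc_of_le (by positivity)] at hθ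
    exact abs_le.mpr ⟨by linarith [hθ.1], by linarith [hθ.2]⟩
  have hne : ∀ᵐ θ : ℝ, θ ≠ Real.pi := MeasureTheory.Measure.ae_ne _ _
  have hexp : ∀ θ : ℝ, ‖exp (-(n * θ * I))‖ = 1 := fun θ => by
    simpa using norm_exp_ofReal_mul_I (-(n * θ))
  refine intervalIntegral.tendsto_integral_filter_of_dominated_convergence
    (fun θ => C * (Real.pi ^ a * |θ - Real.pi| ^ (-a))) ?_ ?_
    (((intervalIntegrable_abs_sub_pi_rpow (by linarith)).const_mul _).const_mul _) ?_
  · filter_upwards [hI1] with r hr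
    refine Continuous.aestronglyMeasurable ?_
    refine Continuous.mul (by fun_prop) (hG.continuousOn.comp_continuous (continuous_circleMap 0 r)
      fun θ => ?_)
    simp [abs_of_pos hr.1, hr.2]
  · filter_upwards [hI1] with r hr
    filter_upwards [hne] with θ hθ hθm
    rw [norm_mul, hexp, one_mul]
    refine (hbound _ (by simp [abs_of_pos hr.1, hr.2])).trans ?_
    gcongr
    have hpos : 0 < |θ - Real.pi| := abs_pos.mpr (sub_ne_zero.mpr hθ)
    calc ‖1 + circleMap 0 r θ‖ ^ (-a) ≤ (|θ - Real.pi| / Real.pi) ^ (-a) :=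
          Real.rpow_le_rpow_of_nonpos (by positivity)
            (abs_sub_pi_div_pi_le_norm_one_add_circleMap hr.1.le (hmem θ hθm)) (by linarith)
      _ = Real.pi ^ a * |θ - Real.pi| ^ (-a) := by
          rw [Real.div_rpow hpos.le hpi.le, Real.rpow_neg hpi.le, div_inv_eq_mul, mul_comm]
  · filter_upwards [hne] with θ hθ hθm
    refine Tendsto.const_mul _ ?_
    have hmap : Tendsto (fun r : ℝ => circleMap 0 r θ) (𝓝[<] 1)
        (𝓝[Metric.closedBall 0 1 \ {-1}] circleMap 0 1 θ) := by
      refine tendsto_nhdsWithin_iff.mpr ⟨?_, ?_⟩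
      · have : Continuous fun r : ℝ => circleMap 0 r θ := by unfold circleMap; fun_prop
        exact (this.tendsto 1).mono_left nhdsWithin_le_nhds
      · filter_upwards [hI1] with r hr
        have hr' : ‖circleMap 0 r θ‖ < 1 := by simp [abs_of_pos hr.1, hr.2]
        refine ⟨by simpa using hr'.le, fun h => ?_⟩
        rw [mem_singleton_iff.mp h] at hr'
        simp at hr'
    refine (hGc _ ⟨by simp, fun h => ?_⟩).tendsto.comp hmap
    have h2 := abs_sub_pi_div_pi_le_norm_one_add_circleMap zero_le_one (hmem θ hθm)
    rw [mem_singleton_iff.mp h] at h2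
    have hpos : 0 < |θ - Real.pi| / Real.pi := div_pos (abs_pos.mpr (sub_ne_zero.mpr hθ)) hpi
    simp at h2
    linarith

/-- The Riemann-Lebesgue lemma for the boundary function of `G`. -/
lemma tendsto_iteratedDeriv_div_factorial_zero {G : ℂ → ℂ} {C a : ℝ}
    (hG : DifferentiableOn ℂ G (Metric.ball 0 1))
    (hGc : ContinuousOn G (Metric.closedBall 0 1 \ {-1})) (hC : 0 ≤ C) (ha0 : 0 ≤ a) (ha1 : a < 1)
    (hbound : ∀ w ∈ Metric.ball (0 : ℂ) 1, ‖G w‖ ≤ C * ‖1 + w‖ ^ (-a)) :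
    Tendsto (fun n : ℕ => iteratedDeriv n G 0 / n.factorial) atTop (𝓝 0) := by
  have hpi := Real.pi_pos
  simp_rw [iteratedDeriv_div_factorial_eq_integral hG hGc hC ha0 ha1 hbound]
  suffices h : Tendsto (fun n : ℕ => ∫ θ in (0 : ℝ)..2 * Real.pi,
      exp (-(n * θ * I)) * G (circleMap 0 1 θ)) atTop (𝓝 0) by
    simpa only [mul_zero] using h.const_mul (2 * Real.pi : ℂ)⁻¹
  have hRL := Real.tendsto_integral_exp_smul_cocompact
    ((Ioc 0 (2 * Real.pi)).indicator fun θ : ℝ => G (circleMap 0 1 θ))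
  have hn : Tendsto (fun n : ℕ => (n : ℝ) / (2 * Real.pi)) atTop (cocompact ℝ) :=
    (tendsto_natCast_atTop_atTop.atTop_div_const (by positivity)).mono_right atTop_le_cocompact
  refine (hRL.comp hn).congr fun n => ?_
  rw [intervalIntegral.integral_of_le (by positivity),
    ← MeasureTheory.integral_indicator measurableSet_Ioc]
  refine MeasureTheory.integral_congr_ae (.of_forall fun θ => ?_)
  simp only [indicator, Circle.smul_def, Real.fourierChar_apply, smul_eq_mul]
  split_ifs
  · congr 1
    have : (Real.pi : ℂ) ≠ 0 := by exact_mod_cast Real.pi_ne_zero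
    congr 1
    push_cast
    field_simp
  · simp

lemma iteratedDeriv_succ_const_add_sub_mul {F G : ℂ → ℂ} {V : Set ℂ} (hV : IsOpen V)
    (hG : DifferentiableOn ℂ G V) {c w₀ : ℂ} (hF : ∀ w ∈ V, F w = c + (w - w₀) * G w) (n : ℕ)
    {w : ℂ} (hw : w ∈ V) :
    iteratedDeriv (n + 1) F w =
      (w - w₀) * iteratedDeriv (n + 1) G w + (n + 1) * iteratedDeriv n G w := by
  have hD (k : ℕ) {z : ℂ} (hz : z ∈ V) :
      HasDerivAt (iteratedDeriv k G) (iteratedDeriv (k + 1) G z) z := by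
    have : DifferentiableAt ℂ (iteratedDeriv k G) z := by
      rw [iteratedDeriv_eq_iterate]
      exact ((hG.analyticOnNhd hV _ hz).iterated_deriv k).differentiableAt
    rw [iteratedDeriv_succ]
    exact this.hasDerivAt
  induction n generalizing w with
  | zero =>
    have hev : F =ᶠ[𝓝 w] fun z => c + (z - w₀) * G z := (hV.eventually_mem hw).mono hF
    have hG0 := hD 0 hw
    rw [iteratedDeriv_zero] at hG0
    rw [iteratedDeriv_succ, iteratedDeriv_zero, hev.deriv_eq]
    have h := (((hasDerivAt_id w).sub_const w₀).mul hG0).const_add c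
    refine h.deriv.trans ?_
    simp; ring
  | succ n ih =>
    have hev : iteratedDeriv (n + 1) F =ᶠ[𝓝 w] fun z =>
        (z - w₀) * iteratedDeriv (n + 1) G z + (n + 1) * iteratedDeriv n G z :=
      (hV.eventually_mem hw).mono fun z hz => ih hz
    rw [iteratedDeriv_succ, hev.deriv_eq]
    have h := (((hasDerivAt_id w).sub_const w₀).mul (hD (n + 1) hw)).add
      ((hD n hw).const_mul ((n : ℂ) + 1))
    refine h.deriv.trans ?_
    simp; ring

/-- If `F w = c + (w - w₀) * G w`, then the partial sums at `w₀` of the Taylor series of `F`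
telescope. -/
lemma sum_taylor_eq {F G : ℂ → ℂ} {V : Set ℂ} (hV : IsOpen V) (h0 : (0 : ℂ) ∈ V)
    (hG : DifferentiableOn ℂ G V) {c w₀ : ℂ} (hF : ∀ w ∈ V, F w = c + (w - w₀) * G w) (N : ℕ) :
    ∑ n ∈ Finset.range (N + 1), iteratedDeriv n F 0 / n.factorial * w₀ ^ n =
      c - w₀ ^ (N + 1) * (iteratedDeriv N G 0 / N.factorial) := by
  induction N with
  | zero => simp [hF 0 h0]; ring
  | succ N ih =>
    rw [Finset.sum_range_succ, ih, iteratedDeriv_succ_const_add_sub_mul hV hG hF N h0,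
      Nat.factorial_succ]
    have h1 : (N.factorial : ℂ) ≠ 0 := by exact_mod_cast N.factorial_ne_zero
    have h2 : ((N : ℂ) + 1) ≠ 0 := by exact_mod_cast N.succ_ne_zero
    push_cast
    field_simp
    ring

/-- Convergence of a Taylor series at a point of the boundary circle where the function is
holomorphic, given one singularity on the circle that is weaker than a simple pole. -/
theorem tendsto_sum_taylor_of_norm_eq_one {F : ℂ → ℂ} {U : Set ℂ} {C a : ℝ} (hU : IsOpen U)
    (hUb : Metric.closedBall 0 1 \ {-1} ⊆ U) (hF : DifferentiableOn ℂ F U) (hC : 0 ≤ C)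
    (ha0 : 0 ≤ a) (ha1 : a < 1)
    (hbound : ∀ w ∈ Metric.ball (0 : ℂ) 1, ‖F w‖ ≤ C * ‖1 + w‖ ^ (-a)) {w₀ : ℂ}
    (hw₀ : ‖w₀‖ = 1) (hw₀' : w₀ ≠ -1) :
    Tendsto (fun N => ∑ n ∈ Finset.range (N + 1), iteratedDeriv n F 0 / n.factorial * w₀ ^ n)
      atTop (𝓝 (F w₀)) := by
  have hw₀U : w₀ ∈ U := hUb ⟨by simp [hw₀], hw₀'⟩
  have hUn : U ∈ 𝓝 w₀ := hU.mem_nhds hw₀U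
  set G := dslope F w₀
  have hG : DifferentiableOn ℂ G U := (Complex.differentiableOn_dslope hUn).mpr hF
  have hball : Metric.ball (0 : ℂ) 1 ⊆ U := fun w hw => hUb ⟨Metric.ball_subset_closedBall hw, by
    rintro rfl; simp at hw⟩
  have hFG : ∀ w ∈ Metric.ball (0 : ℂ) 1, F w = F w₀ + (w - w₀) * G w := fun w _ => by
    have := sub_smul_dslope F w₀ w
    rw [smul_eq_mul] at this
    rw [this]; ring
  obtain ⟨δ, hδ, hδG⟩ : ∃ δ > 0, ∀ w, dist w w₀ < δ → ‖G w‖ < ‖G w₀‖ + 1 := by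
    have hcont : ContinuousAt G w₀ := (hG.differentiableAt hUn).continuousAt
    exact Metric.eventually_nhds_iff.mp (hcont.norm.eventually_lt_const (lt_add_one _))
  -- `G` is bounded near `w₀`, and `‖w - w₀‖` is bounded below elsewhere
  have hGb : ∀ w ∈ Metric.ball (0 : ℂ) 1,
      ‖G w‖ ≤ ((C + 2 ^ a * ‖F w₀‖) / δ + 2 ^ a * (‖G w₀‖ + 1)) * ‖1 + w‖ ^ (-a) := by
    intro w hw
    have hpos : 0 < ‖1 + w‖ := norm_pos_iff.mpr fun h => by
      rw [eq_neg_of_add_eq_zero_right h] at hw; simp at hw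
    have hle : ‖1 + w‖ ≤ 2 := (norm_add_le _ _).trans (by
      have : ‖w‖ < 1 := by simpa using hw
      rw [norm_one]; linarith)
    have hone : 1 ≤ 2 ^ a * ‖1 + w‖ ^ (-a) := by
      rw [Real.rpow_neg hpos.le, ← div_eq_mul_inv, one_le_div (by positivity)]
      gcongr
    rw [add_mul]
    rcases lt_or_ge (dist w w₀) δ with h | h
    · calc ‖G w‖ ≤ (‖G w₀‖ + 1) * 1 := by rw [mul_one]; exact (hδG w h).le
        _ ≤ (‖G w₀‖ + 1) * (2 ^ a * ‖1 + w‖ ^ (-a)) := by gcongr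
        _ = 2 ^ a * (‖G w₀‖ + 1) * ‖1 + w‖ ^ (-a) := by ring
        _ ≤ _ := le_add_of_nonneg_left (by positivity)
    · rw [dist_eq_norm] at h
      have h1 : ‖w - w₀‖ * ‖G w‖ = ‖F w - F w₀‖ := by
        rw [← norm_mul, hFG w hw]; congr 1; ring
      have h2 : ‖F w - F w₀‖ ≤ (C + 2 ^ a * ‖F w₀‖) * ‖1 + w‖ ^ (-a) := by
        refine (norm_sub_le _ _).trans ?_
        have := mul_le_mul_of_nonneg_left hone (norm_nonneg (F w₀))
        have := hbound w hw
        linarith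
      have h3 : ‖G w‖ ≤ (C + 2 ^ a * ‖F w₀‖) / δ * ‖1 + w‖ ^ (-a) := by
        rw [div_mul_eq_mul_div, le_div_iff₀ hδ, mul_comm]
        exact (mul_le_mul_of_nonneg_right h (norm_nonneg _)).trans (h1.trans_le h2)
      exact h3.trans (le_add_of_nonneg_right (by positivity))
  have hg := tendsto_iteratedDeriv_div_factorial_zero (hG.mono hball)
    (hG.continuousOn.mono hUb) (by positivity) ha0 ha1 hGb
  simp_rw [sum_taylor_eq Metric.isOpen_ball (Metric.mem_ball_self one_pos) (hG.mono hball) hFG]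
  rw [← sub_zero (F w₀)]
  refine Tendsto.sub (by simp) ?_
  rw [tendsto_zero_iff_norm_tendsto_zero] at hg ⊢
  simpa [hw₀] using hg

/-! ### Higher derivatives of a function of `(1 + w)⁻¹` -/

/-- The Lah numbers `(n ! / k !) * (n - 1).choose (k - 1)`, the coefficients of the higher
derivatives of a function of `1 / w`, defined by the recursion that differentiation produces. -/
def lah : ℕ → ℕ → ℕ
  | 0, 0 => 1
  | 0, _ + 1 => 0
  | _ + 1, 0 => 0
  | n + 1, k + 1 => (n + k + 1) * lah n (k + 1) + lah n k

lemma lah_zero_right {n : ℕ} (hn : n ≠ 0) : lah n 0 = 0 := by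
  cases n <;> simp_all [lah]

lemma lah_mul_factorial (n k : ℕ) :
    lah (n + 1) (k + 1) * (k + 1).factorial = (n + 1).factorial * n.choose k := by
  induction n generalizing k with
  | zero => cases k <;> simp [lah]
  | succ n ih =>
    rw [lah, add_mul, mul_assoc, ih]
    cases k with
    | zero =>
      rw [lah_zero_right (by omega), Nat.factorial_succ (n + 1)]
      simp
    | succ k =>
      have hk := ih k
      have hp := Nat.choose_succ_succ n k
      have hq : n.choose (k + 1) * (k + 1) + n.choose k * (k + 1) = n.choose k * (n + 1) := by
        have h := Nat.choose_succ_right_eq n k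
        rcases le_or_gt k n with hkn | hkn
        · obtain ⟨d, rfl⟩ := Nat.exists_eq_add_of_le hkn
          simp only [Nat.add_sub_cancel_left] at h
          rw [h]; ring
        · simp [Nat.choose_eq_zero_of_lt hkn, Nat.choose_eq_zero_of_lt (hkn.trans (Nat.lt_succ_self k))]
      rw [Nat.factorial_succ (k + 1), Nat.factorial_succ (n + 1)]
      have : lah (n + 1) (k + 1) * ((k + 1 + 1) * (k + 1).factorial)
        = (k + 2) * ((n + 1).factorial * n.choose k) := by rw [← hk]; ring
      rw [this, hp]
      linear_combination (n + 1).factorial * hq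

lemma lah_eq_zero_of_lt {n k : ℕ} (h : n < k) : lah n k = 0 := by
  induction n generalizing k with
  | zero => obtain ⟨k, rfl⟩ := Nat.exists_eq_add_of_lt h; simp [lah]
  | succ n ih =>
    obtain ⟨k, rfl⟩ : ∃ j, k = j + 1 := ⟨k - 1, by omega⟩
    rw [lah, ih (by omega), ih (by omega)]; simp

lemma iteratedDeriv_comp_const_add_inv {Φ : ℂ → ℂ} {V : Set ℂ} (hV : IsOpen V)
    (hΦ : DifferentiableOn ℂ Φ V) (α : ℂ) (n : ℕ) {w : ℂ} (hw : 1 + w ≠ 0)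
    (hwV : α + (1 + w)⁻¹ ∈ V) :
    iteratedDeriv n (fun w => Φ (α + (1 + w)⁻¹)) w = (-1) ^ n *
      ∑ k ∈ Finset.range (n + 1),
        lah n k * iteratedDeriv k Φ (α + (1 + w)⁻¹) * (1 + w)⁻¹ ^ (n + k) := by
  induction n generalizing w with
  | zero => simp [lah]
  | succ n ih =>
    have hinv : HasDerivAt (fun w : ℂ => (1 + w)⁻¹) (-(1 + w)⁻¹ ^ 2) w := by
      convert! ((hasDerivAt_id w).const_add 1).inv hw using 1
      simp [div_eq_mul_inv]
    have hD (k : ℕ) : HasDerivAt (fun w : ℂ => iteratedDeriv k Φ (α + (1 + w)⁻¹))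
        (iteratedDeriv (k + 1) Φ (α + (1 + w)⁻¹) * -(1 + w)⁻¹ ^ 2) w := by
      have h1 : DifferentiableAt ℂ (iteratedDeriv k Φ) (α + (1 + w)⁻¹) := by
        rw [iteratedDeriv_eq_iterate]
        exact ((hΦ.analyticOnNhd hV _ hwV).iterated_deriv k).differentiableAt
      rw [iteratedDeriv_succ]
      exact h1.hasDerivAt.comp w (hinv.const_add α)
    have hev : iteratedDeriv n (fun w => Φ (α + (1 + w)⁻¹)) =ᶠ[𝓝 w] fun w => (-1) ^ n *
        ∑ k ∈ Finset.range (n + 1),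
          lah n k * iteratedDeriv k Φ (α + (1 + w)⁻¹) * (1 + w)⁻¹ ^ (n + k) := by
      have h1 : ∀ᶠ z in 𝓝 w, 1 + z ≠ 0 :=
        (continuous_const.add continuous_id).continuousAt.eventually_ne hw
      have h2 : ∀ᶠ z in 𝓝 w, α + (1 + z)⁻¹ ∈ V :=
        (hinv.const_add α).continuousAt.eventually (hV.mem_nhds hwV)
      filter_upwards [h1, h2] with z hz1 hz2 using ih hz1 hz2
    rw [iteratedDeriv_succ, hev.deriv_eq]
    have hsum := (HasDerivAt.fun_sum (u := Finset.range (n + 1)) fun k _ =>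
      ((hD k).const_mul (lah n k : ℂ)).mul (hinv.pow (n + k))).const_mul ((-1 : ℂ) ^ n)
    refine hsum.deriv.trans ?_
    set x := (1 + w)⁻¹
    rw [Finset.sum_range_succ' _ (n + 1), lah_zero_right (by omega), pow_succ (-1 : ℂ), mul_assoc]
    congr 1
    -- splitting the sums into the contributions of the two terms of the Lah recursion
    have e1 (k : ℕ) : (lah n k : ℂ) * (iteratedDeriv (k + 1) Φ (α + x) * -x ^ 2) * x ^ (n + k)
        + lah n k * iteratedDeriv k Φ (α + x) * (((n + k : ℕ) : ℂ) * x ^ (n + k - 1) * -x ^ 2)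
        = -(lah n k * iteratedDeriv (k + 1) Φ (α + x) * x ^ (n + k + 2))
          - (n + k) * lah n k * iteratedDeriv k Φ (α + x) * x ^ (n + k + 1) := by
      rcases Nat.eq_zero_or_pos (n + k) with h | h
      · obtain ⟨rfl, rfl⟩ : n = 0 ∧ k = 0 := by omega
        simp; ring
      · obtain ⟨j, hj⟩ : ∃ j, n + k = j + 1 := ⟨n + k - 1, by omega⟩
        have : ((n : ℂ) + k) = j + 1 := by exact_mod_cast hj
        rw [this, hj]; rw [Nat.add_sub_cancel]; push_cast; ring
    have e2 (k : ℕ) : (lah (n + 1) (k + 1) : ℂ) * iteratedDeriv (k + 1) Φ (α + x) *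
          x ^ (n + 1 + (k + 1))
        = lah n k * iteratedDeriv (k + 1) Φ (α + x) * x ^ (n + k + 2) +
          (n + (k + 1 : ℕ)) * lah n (k + 1) * iteratedDeriv (k + 1) Φ (α + x)
            * x ^ (n + (k + 1) + 1) := by
      rw [lah]; push_cast; ring
    have e3 := Finset.sum_range_succ' (fun k : ℕ =>
      ((n : ℂ) + k) * lah n k * iteratedDeriv k Φ (α + x) * x ^ (n + k + 1)) (n + 1)
    rw [Finset.sum_range_succ, lah_eq_zero_of_lt (Nat.lt_succ_self n)] at e3
    have e4 : ((n : ℂ) + (0 : ℕ)) * lah n 0 * iteratedDeriv 0 Φ (α + x) * x ^ (n + 0 + 1) = 0 := by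
      rcases Nat.eq_zero_or_pos n with rfl | h
      · simp
      · rw [lah_zero_right h.ne']; simp
    rw [e4] at e3
    simp only [Pi.pow_apply]
    rw [Finset.sum_congr rfl fun k _ => e1 k, Finset.sum_congr rfl fun k _ => e2 k,
      Finset.sum_add_distrib, Finset.sum_sub_distrib, Finset.sum_neg_distrib]
    simp only [Nat.cast_zero, zero_mul, mul_zero, add_zero] at e3 ⊢
    rw [e3]; ring

/-- At the centre the factors `(1 + w)⁻¹` are `1`, and the Lah numbers divided by `n !` become
binomial coefficients. -/
lemma iteratedDeriv_comp_const_add_inv_zero {Φ : ℂ → ℂ} {V : Set ℂ} (hV : IsOpen V)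
    (hΦ : DifferentiableOn ℂ Φ V) {α : ℂ} (hα : α + 1 ∈ V) {n : ℕ} (hn : 1 ≤ n) :
    iteratedDeriv n (fun w => Φ (α + (1 + w)⁻¹)) 0 / n.factorial = (-1) ^ n *
      ∑ k ∈ Finset.Icc 1 n, ((n - 1).choose (k - 1) : ℂ) *
        (1 / (k.factorial : ℂ) * iteratedDeriv k Φ (α + 1)) := by
  obtain ⟨n, rfl⟩ : ∃ m, n = m + 1 := ⟨n - 1, by omega⟩
  rw [iteratedDeriv_comp_const_add_inv hV hΦ α _ (by simp) (by simpa using hα),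
    Finset.sum_range_succ', lah_zero_right (by omega), mul_div_assoc]
  congr 1
  rw [← Finset.Ico_add_one_right_eq_Icc, Finset.sum_Ico_eq_sum_range]
  simp only [Nat.cast_zero, zero_mul, add_zero, inv_one, one_pow, mul_one, Finset.sum_div]
  refine Finset.sum_congr rfl fun k _ => ?_
  have h := congrArg (Nat.cast (R := ℂ)) (lah_mul_factorial n k)
  push_cast at h
  have h1 : ((n + 1).factorial : ℂ) ≠ 0 := by exact_mod_cast Nat.factorial_ne_zero _
  have h2 : ((k + 1).factorial : ℂ) ≠ 0 := by exact_mod_cast Nat.factorial_ne_zero _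
  rw [add_comm 1 k, Nat.add_sub_cancel, Nat.add_sub_cancel]
  field_simp
  linear_combination iteratedDeriv (k + 1) Φ (α + 1) * h

/-! ### The expansion on a vertical line -/

/-- The `e_n`-expansion on the line `re s = σ₀` of a function holomorphic to the right of some
smaller abscissa and of growth `‖s‖ ^ a`, `a < 1`, in `σ₀ ≤ re s`. -/
theorem seriesFromOneConvergesTo_of_norm_le {Φ : ℂ → ℂ} {σ₀ σ₁ C a : ℝ} (hσ₀ : 1 / 2 < σ₀)
    (hσ₁ : σ₁ < σ₀) (hΦ : DifferentiableOn ℂ Φ {s | σ₁ < s.re}) (hC : 0 ≤ C) (ha0 : 0 ≤ a)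
    (ha1 : a < 1) (hbound : ∀ s : ℂ, σ₀ ≤ s.re → ‖Φ s‖ ≤ C * ‖s‖ ^ a) (t : ℝ) :
    SeriesFromOneConvergesTo (fun n => ((-1) ^ n *
      ∑ k ∈ Finset.Icc 1 n, ((n - 1).choose (k - 1) : ℂ) *
        (1 / (k.factorial : ℂ) * iteratedDeriv k Φ ((σ₀ : ℂ) + 1 / 2))) * fourierE (n : ℤ) t)
      (Φ ((σ₀ : ℂ) + I * t) - Φ ((σ₀ : ℂ) + 1 / 2)) := by
  have hVo : IsOpen {s : ℂ | σ₁ < s.re} := isOpen_lt continuous_const continuous_re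
  set α : ℂ := (σ₀ : ℂ) - 1 / 2 with hα
  have hαre : α.re = σ₀ - 1 / 2 := by simp [hα]
  have hα1 : α + 1 = (σ₀ : ℂ) + 1 / 2 := by rw [hα]; ring
  set F : ℂ → ℂ := fun w => Φ (α + (1 + w)⁻¹) with hFdef
  -- the map `w ↦ (1 + w)⁻¹` sends the closed unit disc without `-1` to `1 / 2 ≤ re s`
  have hre : ∀ w : ℂ, w ≠ -1 → ‖w‖ ≤ 1 → 1 / 2 ≤ ((1 + w)⁻¹).re := by
    intro w hw hw1
    have hne : 1 + w ≠ 0 := fun h => hw (eq_neg_of_add_eq_zero_right h)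
    rw [inv_re, le_div_iff₀ (normSq_pos.mpr hne)]
    have h1 : normSq w ≤ 1 := by rw [normSq_eq_norm_sq]; exact pow_le_one₀ (norm_nonneg _) hw1
    rw [normSq_apply] at h1 ⊢
    simp only [add_re, one_re, add_im, one_im, zero_add]
    nlinarith
  -- `w ≠ -1` is required separately, since `(1 + w)⁻¹ = 0` there may still satisfy the inequality
  set U : Set ℂ := {w | w ≠ -1} ∩ (fun w => α + (1 + w)⁻¹) ⁻¹' {s | σ₁ < s.re}
  have hmapd : DifferentiableOn ℂ (fun w : ℂ => α + (1 + w)⁻¹) {w | w ≠ -1} := fun w hw =>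
    (DifferentiableAt.const_add _ (DifferentiableAt.inv (by fun_prop) fun h =>
      hw (eq_neg_of_add_eq_zero_right h))).differentiableWithinAt
  have hUo : IsOpen U := hmapd.continuousOn.isOpen_inter_preimage isOpen_ne hVo
  have hUb : Metric.closedBall 0 1 \ {-1} ⊆ U := fun w hw => by
    refine ⟨hw.2, ?_⟩
    have := hre w hw.2 (by simpa using hw.1)
    simp only [mem_preimage, mem_ofPred_eq, add_re, hαre]
    linarith
  have hF : DifferentiableOn ℂ F U := hΦ.comp (hmapd.mono inter_subset_left) fun w hw => hw.2
  have hFb : ∀ w ∈ Metric.ball (0 : ℂ) 1, ‖F w‖ ≤ C * (2 * σ₀) ^ a * ‖1 + w‖ ^ (-a) := by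
    intro w hw
    have hw' : w ≠ -1 := by rintro rfl; simp at hw
    have hw1 : ‖w‖ ≤ 1 := by simpa using (Metric.ball_subset_closedBall hw)
    have hpos : 0 < ‖1 + w‖ := norm_pos_iff.mpr fun h => hw' (eq_neg_of_add_eq_zero_right h)
    have hle : ‖1 + w‖ ≤ 2 := (norm_add_le _ _).trans (by rw [norm_one]; linarith)
    refine (hbound _ ?_).trans ?_
    · rw [add_re, hαre]; linarith [hre w hw' hw1]
    have hnα : ‖α‖ = σ₀ - 1 / 2 := by
      rw [show α = ((σ₀ - 1 / 2 : ℝ) : ℂ) by rw [hα]; push_cast; ring, norm_real,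
        Real.norm_of_nonneg (by linarith)]
    have h1 : ‖α + (1 + w)⁻¹‖ ≤ 2 * σ₀ / ‖1 + w‖ := by
      refine (norm_add_le _ _).trans ?_
      rw [hnα, norm_inv, le_div_iff₀ hpos, add_mul, inv_mul_cancel₀ hpos.ne']
      nlinarith
    calc C * ‖α + (1 + w)⁻¹‖ ^ a ≤ C * (2 * σ₀ / ‖1 + w‖) ^ a := by gcongr
      _ = C * (2 * σ₀) ^ a * ‖1 + w‖ ^ (-a) := by
        rw [Real.div_rpow (by linarith) hpos.le, Real.rpow_neg hpos.le, div_eq_mul_inv, mul_assoc]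
  set w₀ : ℂ := (1 / 2 - I * t) / (1 / 2 + I * t) with hw₀
  have hden : (1 / 2 + I * t : ℂ) ≠ 0 := fun h => by simpa using congrArg re h
  have hw₀s : 1 + w₀ = (1 / 2 + I * t)⁻¹ := by
    have h : (1 / 2 + I * t : ℂ) + (1 / 2 - I * t) = 1 := by ring
    rw [hw₀, ← mul_left_inj' hden, add_mul, one_mul, div_mul_cancel₀ _ hden, h,
      inv_mul_cancel₀ hden]
  have hw₀1 : w₀ ≠ -1 := fun h => by
    rw [h] at hw₀s
    exact inv_ne_zero hden (by rw [← hw₀s]; ring)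
  have hw₀n : ‖w₀‖ = 1 := by
    have : (1 / 2 - I * t : ℂ) = (starRingEnd ℂ) (1 / 2 + I * t) := by
      simp [sub_eq_add_neg, ← ofReal_ofNat]
    rw [hw₀, norm_div, this, norm_conj, div_self (norm_ne_zero_iff.mpr hden)]
  have key := tendsto_sum_taylor_of_norm_eq_one hUo hUb hF
    (mul_nonneg hC (Real.rpow_nonneg (by linarith) a)) ha0 ha1 hFb hw₀n hw₀1
  have hFw₀ : F w₀ = Φ ((σ₀ : ℂ) + I * t) := by
    simp only [hFdef]
    rw [hw₀s, inv_inv, hα]; congr 1; ring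
  have hF0 : F 0 = Φ ((σ₀ : ℂ) + 1 / 2) := by
    simp only [hFdef]
    rw [add_zero, inv_one, hα1]
  rw [hFw₀] at key
  rw [← hF0]
  refine (key.sub_const (F 0)).congr fun N => ?_
  rw [Finset.range_eq_Ico, Finset.sum_eq_sum_Ico_succ_bot (by omega), iteratedDeriv_zero]
  simp only [Nat.factorial_zero, Nat.cast_one, div_one, pow_zero, mul_one, add_sub_cancel_left]
  rw [zero_add, Finset.Ico_add_one_right_eq_Icc]
  refine Finset.sum_congr rfl fun n hn => ?_
  have hαV : α + 1 ∈ {s : ℂ | σ₁ < s.re} := by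
    simp only [mem_ofPred_eq, add_re, one_re, hαre]; linarith
  rw [iteratedDeriv_comp_const_add_inv_zero hVo hΦ hαV (Finset.mem_Icc.mp hn).1, hα1, fourierE,
    zpow_natCast]

lemma iteratedDeriv_riemannZeta₀ {s : ℂ} (hs : s ≠ 1) (k : ℕ) :
    iteratedDeriv k riemannZeta₀ s =
      iteratedDeriv k riemannZeta s - (-1) ^ k * k.factorial / (s - 1) ^ (k + 1) := by
  have hs1 : s - 1 ≠ 0 := sub_ne_zero.mpr hs
  have hev : riemannZeta₀ =ᶠ[𝓝 s] riemannZeta - fun z => (1 * z + (-1))⁻¹ := by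
    filter_upwards [isOpen_ne.mem_nhds hs] with z hz
    rw [Pi.sub_apply, riemannZeta_eq_inv_sub_add hz, one_mul, ← sub_eq_add_neg,
      add_sub_cancel_left]
  have hζ : ContDiffAt ℂ k riemannZeta s :=
    (differentiableOn_riemannZeta.analyticAt (isOpen_compl_singleton.mem_nhds hs)).contDiffAt
  have hinv : ContDiffAt ℂ k (fun z : ℂ => (1 * z + (-1))⁻¹) s :=
    ContDiffAt.inv (by fun_prop) (by rwa [one_mul, ← sub_eq_add_neg])
  rw [hev.iteratedDeriv_eq, iteratedDeriv_sub hζ hinv,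
    iteratedDeriv_eq_iterate (f := fun z : ℂ => (1 * z + -1)⁻¹),
    iter_deriv_inv_linear]
  simp only [one_pow, mul_one, one_mul, ← sub_eq_add_neg]
  rw [show (-1 - k : ℤ) = -((k + 1 : ℕ) : ℤ) by push_cast; ring, zpow_neg, zpow_natCast,
    div_eq_mul_inv]

theorem theorem2 (σ₀ : ℝ) (hσ₀ : 1 / 2 < σ₀) (t : ℝ) :
    (σ₀ < 1 → ∃ S : ℂ,
      SeriesFromOneConvergesTo (fun n => ell σ₀ n * fourierE (n : ℤ) t) S ∧
      riemannZeta ((σ₀ : ℂ) + Complex.I * (t : ℂ)) =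
        riemannZeta ((σ₀ : ℂ) + 1 / 2) - 1 / ((σ₀ : ℂ) - 1 / 2)
          + 1 / ((σ₀ : ℂ) - 1 + Complex.I * (t : ℂ)) + S) ∧
    (1 < σ₀ → ∃ S : ℂ,
      SeriesFromOneConvergesTo (fun n => ell σ₀ n * fourierE (n : ℤ) t) S ∧
      riemannZeta ((σ₀ : ℂ) + Complex.I * (t : ℂ)) =
        riemannZeta ((σ₀ : ℂ) + 1 / 2) + S) := by
  -- `a = 1 / 2` satisfies `1 < σ₀ + a` and `a < 1`
  obtain ⟨C, hC, hbound⟩ := exists_norm_riemannZeta₀_le (σ := σ₀) (a := 1 / 2) (by linarith)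
    (by norm_num) (by norm_num) (by linarith)
  have hcenter : (σ₀ : ℂ) + 1 / 2 ≠ 1 := fun h => by
    have := congrArg re h
    simp at this
    linarith
  constructor
  · intro h1
    have hline : (σ₀ : ℂ) + I * t ≠ 1 := fun h => by
      have := congrArg re h
      simp at this
      linarith
    refine ⟨riemannZeta₀ ((σ₀ : ℂ) + I * t) - riemannZeta₀ ((σ₀ : ℂ) + 1 / 2), ?_, ?_⟩
    · convert! seriesFromOneConvergesTo_of_norm_le hσ₀ (sub_one_lt σ₀)
        differentiable_riemannZeta₀.differentiableOn hC (by norm_num) (by norm_num) hbound t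
        using 4 with n
      rw [ell, if_pos h1, ellStrip]
      congr 1
      refine Finset.sum_congr rfl fun k _ => ?_
      rw [iteratedDeriv_riemannZeta₀ hcenter, mul_sub (1 / (k.factorial : ℂ))]
      congr 2
      have hk : (k.factorial : ℂ) ≠ 0 := by exact_mod_cast k.factorial_ne_zero
      rw [show (σ₀ : ℂ) + 1 / 2 - 1 = σ₀ - 1 / 2 by ring]
      field_simp
    · rw [riemannZeta_eq_inv_sub_add hline, riemannZeta_eq_inv_sub_add hcenter,
        show (σ₀ : ℂ) + 1 / 2 - 1 = σ₀ - 1 / 2 by ring,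
        show (σ₀ : ℂ) + I * t - 1 = σ₀ - 1 + I * t by ring]
      ring
  · intro h1
    refine ⟨riemannZeta ((σ₀ : ℂ) + I * t) - riemannZeta ((σ₀ : ℂ) + 1 / 2), ?_, by ring⟩
    have hne : ∀ s : ℂ, 1 < s.re → s ≠ 1 := by
      rintro s hs rfl
      simp at hs
    have hb : ∀ s : ℂ, σ₀ ≤ s.re → ‖riemannZeta s‖ ≤
        ((σ₀ - 1)⁻¹ + C) * ‖s‖ ^ (1 / 2 : ℝ) := by
      intro s hs
      have hs1 : 1 ≤ ‖s‖ ^ (1 / 2 : ℝ) :=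
        Real.one_le_rpow (h1.le.trans (hs.trans (re_le_norm s))) (by norm_num)
      have hpole : ‖(s - 1)⁻¹‖ ≤ (σ₀ - 1)⁻¹ := by
        rw [norm_inv]
        refine inv_anti₀ (by linarith) (le_trans ?_ (re_le_norm _))
        simpa using hs
      rw [riemannZeta_eq_inv_sub_add (hne s (h1.trans_le hs)), add_mul]
      refine (norm_add_le _ _).trans (add_le_add (hpole.trans ?_) (hbound s hs))
      exact le_mul_of_one_le_right (inv_nonneg.mpr (by linarith)) hs1
    convert! seriesFromOneConvergesTo_of_norm_le hσ₀ h1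
      (fun s hs => (differentiableAt_riemannZeta (hne s hs)).differentiableWithinAt)
      (add_nonneg (inv_nonneg.mpr (by linarith)) hC) (by norm_num) (by norm_num) hb t using 4 with n
    rw [ell, if_neg h1.le.not_gt, ellRight]
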